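/- Let $G$ be an arbitrary (finite or infinite) simple undirected graph. An \emph{end} of $G$ is an equivalence class of rays (one-way infinite paths), where two rays are equivalent if no finite set of vertices separates them; the rays in the class $\omega$ are called \emph{$\omega$-rays}. Let $\deg(\omega)$ be the supremum of the cardinalities of sets of pairwise disjoint $\omega$-rays. A vertex $d$ \emph{dominates} $\omega$ if there is an $\omega$-ray $R$ such that, for every finite $S \subseteq V(G)\setminus\{d\}$, the vertex $d$ and some tail of $R$ lie in the same component of $G-S$; let $\operatorname{dom}(\omega)$ be the cardinality of the set of vertices dominating $\omega$. Put $\Delta(\omega) = \deg(\omega) + \operatorname{dom}(\omega)$ (a sum of cardinals). The end $\omega$ is \emph{in the closure} of a set $A \subseteq V(G)$ if there is a comb with teeth in $A$ whose spine is an $\omega$-ray, that is, an $\omega$-ray $R$ together with infinitely many pairwise disjoint finite (possibly trivial) paths, each having precisely one vertex on $R$, which is one of its endvertices, and having its other endvertex (its only vertex, if it is trivial) in $A$. For $k \in \mathbb{N}$, a set $X$ of at least $k$ vertices is \emph{$k$-connected in $G$} if for all $Z_1, Z_2 \subseteq X$ with $|Z_1| = |Z_2| \le k$ there are $|Z_1|$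 many vertex-disjoint (possibly trivial) paths from $Z_1$ to $Z_2$ in $G$. \textbf{Corollary.} Let $\omega$ be an end of $G$ and let $k \in \mathbb{N} = \{0, 1, 2, \dots\}$ with $\Delta(\omega) \geq k$. Then every set $A \subseteq V(G)$ with $\omega$ in its closure contains a countably infinite subset $A' \subseteq A$ which is $k$-connected in $G$. -/

import Mathlib

open Cardinal

namespace EndConn

universe u

variable {V : Type u}

/-- `u` and `v` lie in the same component of `G - S`: they are joined by a walk of `G`
all of whose vertices (including `u` and `v`) are outside `S`. -/
def JoinedOff (G : SimpleGraph V) (S : Set V) (u v : V) : Prop :=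
  ∃ p : G.Walk u v, ∀ x ∈ p.support, x ∉ S

/-- A ray of `G`: a one-way infinite path, listed from its start vertex. Since the start vertex of
a ray is unique, this listing is determined by the ray as a subgraph. -/
@[ext]
structure Ray (G : SimpleGraph V) where
  /-- the vertices in their order along the ray -/
  vertex : ℕ → V
  injective : Function.Injective vertex
  adj : ∀ n, G.Adj (vertex n) (vertex (n + 1))

/-- The vertex set of a ray. -/
def Ray.verts {G : SimpleGraph V} (R : Ray G) : Set V := Set.range R.vertex

/-- Two rays are equivalent if no finite set `S` of vertices separates them, that is, if for every
finite `S` some component of `G - S` contains a vertex of each of them. -/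
def Ray.Equivalent {G : SimpleGraph V} (R Q : Ray G) : Prop :=
  ∀ S : Set V, S.Finite → ∃ x ∈ R.verts, ∃ y ∈ Q.verts, JoinedOff G S x y

theorem JoinedOff.symm {G : SimpleGraph V} {S : Set V} {u v : V} (h : JoinedOff G S u v) :
    JoinedOff G S v u := by
  obtain ⟨p, hp⟩ := h
  exact ⟨p.reverse, fun x hx => hp x (by simpa using hx)⟩

theorem JoinedOff.trans {G : SimpleGraph V} {S : Set V} {u v w : V} (h : JoinedOff G S u v)
    (h' : JoinedOff G S v w) : JoinedOff G S u w := by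
  obtain ⟨p, hp⟩ := h
  obtain ⟨q, hq⟩ := h'
  refine ⟨p.append q, fun x hx => ?_⟩
  rcases (SimpleGraph.Walk.mem_support_append_iff p q).1 hx with hx | hx
  · exact hp x hx
  · exact hq x hx

theorem JoinedOff.mono {G : SimpleGraph V} {S T : Set V} {u v : V} (hST : S ⊆ T)
    (h : JoinedOff G T u v) : JoinedOff G S u v := by
  obtain ⟨p, hp⟩ := h
  exact ⟨p, fun x hx hxS => hp x hx (hST hxS)⟩

theorem Ray.exists_tail_off {G : SimpleGraph V} (R : Ray G) {S : Set V} (hS : S.Finite) :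
    ∃ N, ∀ n, N ≤ n → R.vertex n ∉ S := by
  have hfin : (R.vertex ⁻¹' S).Finite := hS.preimage R.injective.injOn
  obtain ⟨N, hN⟩ := hfin.bddAbove
  refine ⟨N + 1, fun n hn hnS => ?_⟩
  have := hN hnS
  omega

theorem Ray.joinedOff_add {G : SimpleGraph V} (R : Ray G) {S : Set V} {N : ℕ}
    (hN : ∀ n, N ≤ n → R.vertex n ∉ S) (d : ℕ) :
    JoinedOff G S (R.vertex N) (R.vertex (N + d)) := by
  induction d with
  | zero => exact ⟨.nil, by simpa using hN N le_rfl⟩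
  | succ d ih =>
    refine ih.trans ⟨.cons (R.adj (N + d)) .nil, fun x hx => ?_⟩
    simp only [SimpleGraph.Walk.support_cons, SimpleGraph.Walk.support_nil, List.mem_cons,
      List.not_mem_nil, or_false] at hx
    rcases hx with rfl | rfl
    · exact hN _ (by omega)
    · exact hN _ (by omega)

theorem Ray.equivalent_equivalence (G : SimpleGraph V) :
    Equivalence (Ray.Equivalent (G := G)) := by
  refine ⟨fun R S hS => ?_, fun {R Q} h S hS => ?_, fun {R Q T} h h' S hS => ?_⟩
  · obtain ⟨N, hN⟩ := R.exists_tail_off hS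
    exact ⟨_, ⟨N, rfl⟩, _, ⟨N, rfl⟩, .nil, by simpa using hN N le_rfl⟩
  · obtain ⟨x, hx, y, hy, hxy⟩ := h S hS
    exact ⟨y, hy, x, hx, hxy.symm⟩
  · obtain ⟨N, hN⟩ := Q.exists_tail_off hS
    have hS' : (S ∪ Q.vertex '' Set.Iio N).Finite := hS.union ((Set.finite_Iio N).image _)
    obtain ⟨x, hx, _, ⟨i, rfl⟩, p, hp⟩ := h _ hS'
    obtain ⟨_, ⟨j, rfl⟩, z, hz, q, hq⟩ := h' _ hS'
    have hi : N ≤ i := by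
      by_contra hlt
      exact hp _ p.end_mem_support (Or.inr ⟨i, by simpa using hlt, rfl⟩)
    have hj : N ≤ j := by
      by_contra hlt
      exact hq _ q.start_mem_support (Or.inr ⟨j, by simpa using hlt, rfl⟩)
    obtain ⟨a, rfl⟩ := Nat.exists_eq_add_of_le hi
    obtain ⟨b, rfl⟩ := Nat.exists_eq_add_of_le hj
    have hp' : JoinedOff G S x (Q.vertex (N + a)) :=
      JoinedOff.mono Set.subset_union_left ⟨p, hp⟩
    have hq' : JoinedOff G S (Q.vertex (N + b)) z :=
      JoinedOff.mono Set.subset_union_left ⟨q, hq⟩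
    exact ⟨x, hx, z, hz,
      ((hp'.trans (Q.joinedOff_add hN a).symm).trans (Q.joinedOff_add hN b)).trans hq'⟩

/-- Equivalence of rays, as a setoid. -/
def raySetoid (G : SimpleGraph V) : Setoid (Ray G) :=
  ⟨Ray.Equivalent, Ray.equivalent_equivalence G⟩

/-- The ends of `G`: the equivalence classes of rays. -/
def GraphEnd (G : SimpleGraph V) : Type u := Quotient (raySetoid G)

/-- `R` is an `ω`-ray, that is, an element of the equivalence class `ω`. -/
def Ray.IsIn {G : SimpleGraph V} (R : Ray G) (ω : GraphEnd G) : Prop :=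
  Quotient.mk (raySetoid G) R = ω

/-- The degree of an end: the supremum of the cardinalities of the sets of (pairwise) disjoint
`ω`-rays. -/
noncomputable def GraphEnd.degree {G : SimpleGraph V} (ω : GraphEnd G) : Cardinal.{u} :=
  sSup {c | ∃ F : Set (Ray G), (∀ R ∈ F, R.IsIn ω) ∧ F.PairwiseDisjoint Ray.verts ∧ c = #F}

/-- The set in the definition of the degree is bounded, so that its `sSup` is a true supremum. -/
theorem GraphEnd.bddAbove_degree {G : SimpleGraph V} (ω : GraphEnd G) :
    BddAbove {c : Cardinal.{u} | ∃ F : Set (Ray G), (∀ R ∈ F, R.IsIn ω) ∧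
      F.PairwiseDisjoint Ray.verts ∧ c = #F} := by
  refine ⟨#(Ray G), ?_⟩
  rintro c ⟨F, -, -, rfl⟩
  exact Cardinal.mk_set_le F

/-- A vertex `d` dominates a ray `R` if for every finite set `S` of vertices other than `d`,
the vertex `d` and some tail of `R` lie in the same component of `G - S`. -/
def DominatesRay {G : SimpleGraph V} (d : V) (R : Ray G) : Prop :=
  ∀ S : Set V, S.Finite → d ∉ S → ∃ N, ∀ n, N ≤ n → JoinedOff G S d (R.vertex n)

/-- The set of the vertices that dominate `ω`, i.e. that dominate some `ω`-ray. -/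
def GraphEnd.Dom {G : SimpleGraph V} (ω : GraphEnd G) : Set V :=
  {d | ∃ R : Ray G, R.IsIn ω ∧ DominatesRay d R}

/-- The combined degree `deg(ω) + dom(ω)` of an end. -/
noncomputable def GraphEnd.combinedDegree {G : SimpleGraph V} (ω : GraphEnd G) : Cardinal.{u} :=
  ω.degree + #ω.Dom

/-- A comb: a ray (the spine) with infinitely many disjoint finite, possibly trivial, paths, each
of which has precisely one vertex on the spine, namely its first vertex. (As these paths meet the
spine in distinct vertices there are countably many of them, so they are listed by `ℕ`.) -/
structure Comb (G : SimpleGraph V) where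
  /-- the spine -/
  spine : Ray G
  /-- the endvertices of the finite paths on the spine -/
  foot : ℕ → V
  /-- the other endvertices (the same vertex, for a trivial path) -/
  tooth : ℕ → V
  /-- the finite paths -/
  path : ∀ n, G.Path (foot n) (tooth n)
  foot_mem : ∀ n, foot n ∈ spine.verts
  eq_foot_of_mem : ∀ n, ∀ x ∈ (path n).1.support, x ∈ spine.verts → x = foot n
  disjoint : ∀ m n, m ≠ n → (path m).1.support.Disjoint (path n).1.support

/-- The teeth of a comb. -/
def Comb.teeth {G : SimpleGraph V} (C : Comb G) : Set V := Set.range C.tooth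

/-- `ω` is in the closure of `U`: there is a comb with spine in `ω` and with all teeth in `U`. -/
def GraphEnd.InClosure {G : SimpleGraph V} (ω : GraphEnd G) (U : Set V) : Prop :=
  ∃ C : Comb G, C.spine.IsIn ω ∧ C.teeth ⊆ U

/-- There are `n` vertex-disjoint paths from `Z₁` to `Z₂` in `G`; a path may be trivial, with
its vertex in both sets. -/
def HasDisjointPaths (G : SimpleGraph V) (n : ℕ) (Z₁ Z₂ : Finset V) : Prop :=
  ∃ (s t : Fin n → V) (p : ∀ i, G.Path (s i) (t i)),
    (∀ i, s i ∈ Z₁) ∧ (∀ i, t i ∈ Z₂) ∧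
    ∀ i j, i ≠ j → (p i).1.support.Disjoint (p j).1.support

/-- A set `X` of at least `k` vertices is `k`-connected in `G` if for all `Z₁, Z₂ ⊆ X` with
`|Z₁| = |Z₂| ≤ k` there are `|Z₁|` many vertex-disjoint paths from `Z₁` to `Z₂` in `G`. -/
def IsConnectedSet (G : SimpleGraph V) (k : ℕ) (X : Set V) : Prop :=
  (k : ℕ∞) ≤ X.encard ∧
    ∀ Z₁ Z₂ : Finset V, (Z₁ : Set V) ⊆ X → (Z₂ : Set V) ⊆ X →
      Z₁.card = Z₂.card → Z₁.card ≤ k → HasDisjointPaths G Z₁.card Z₁ Z₂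

end EndConn

/-!
Fix an `ω`-ray `R`, and for finite `S` let `C(S)` be the component of `G - S` that contains a tail
of `R` (`Ray.component`). Call a finite set `F` of vertices `k`-linked if `|F \ C(S)| ≤ |S|` for
every `S` with `|S| < k` (`Ray.IsLinked`). If `Z₁, Z₂` are `k`-linked with `|Z₁| = |Z₂| ≤ k`, then
a set `S` with `|S| < |Z₁|` leaves a vertex of each of them in `C(S)`, so it does not separate
them, and Menger's theorem (`hasDisjointPaths_of_forall_joinedOff`) yields the `|Z₁|` disjoint
paths (`Ray.IsLinked.hasDisjointPaths`). Hence it suffices to find an infinite subset of `A` all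
of whose finite subsets are `k`-linked. It is built one vertex at a time, and the heart of the
proof is that a `k`-linked set `F` can always be extended by a vertex of `A`
(`Ray.IsLinked.exists_insert`).

Two facts are used for this. First, since `k ≤ deg(ω) + dom(ω)`, there is a finite set `K` that
meets `C(S)` whenever `|S| < k`; it consists of dominating vertices and of vertices on disjoint
`ω`-rays (`GraphEnd.exists_finset_meeting_component`). Second, for vertex sets `W` and `K` and a
number `n` some finite set `T` contains a walk from `W` to `K` outside `X` for every `X` with `|X|
≤ n` that does not separate `W` from `K` (`exists_finset_joinedOff`). Let `U` be the union of `F`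
and such sets `T` for all `W ⊆ F` and all single vertices of `K`, and choose `a ∈ A` in `C(U)`,
which the comb allows. If `F ∪ {a}` were not `k`-linked, then for some `S` with `|S| < k` neither
`a` nor any vertex of some `W ⊆ F` with `|W| = |S|` would lie in `C(S)`. As `a ∈ C(U) \ C(S)`, the
set `S` does not lie inside `U`, so `|S ∩ U| < |W|`; as `F` is `k`-linked, `W` meets `C(S ∩ U)`,
and hence `S ∩ U` does not separate `W` from any vertex of `K ∩ C(S)`. By the choice of `U` there
is a walk inside `U` that shows this. It avoids `S`, and so `W` meets `C(S)`, a contradiction.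

The second fact also reduces Menger's theorem to graphs with finitely many edges, where it is
proved by Göring's argument: induction on the number of edges, deleting an edge.
-/

namespace EndConn

universe u

variable {V : Type u}

/-! ### Menger's theorem for finite vertex sets -/

theorem JoinedOff.refl {G : SimpleGraph V} {S : Set V} {u : V} (h : u ∉ S) :
    JoinedOff G S u u :=
  ⟨.nil, by simpa using h⟩

theorem JoinedOff.of_adj {G : SimpleGraph V} {S : Set V} {u v : V} (h : G.Adj u v)
    (hu : u ∉ S) (hv : v ∉ S) : JoinedOff G S u v :=
  ⟨.cons h .nil, by simp [hu, hv]⟩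

theorem JoinedOff.mono_graph {G H : SimpleGraph V} (hGH : G ≤ H) {S : Set V} {u v : V}
    (h : JoinedOff G S u v) : JoinedOff H S u v := by
  obtain ⟨p, hp⟩ := h
  exact ⟨p.mapLe hGH, by simpa using hp⟩

theorem JoinedOff.start_notMem {G : SimpleGraph V} {S : Set V} {u v : V}
    (h : JoinedOff G S u v) : u ∉ S := by
  obtain ⟨p, hp⟩ := h
  exact hp _ p.start_mem_support

theorem JoinedOff.end_notMem {G : SimpleGraph V} {S : Set V} {u v : V}
    (h : JoinedOff G S u v) : v ∉ S :=
  h.symm.start_notMem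

theorem HasDisjointPaths.of_joinedOff {G : SimpleGraph V} {A B : Finset V} {k : ℕ}
    {ι : Type*} [Fintype ι] (hι : Fintype.card ι = k) (C : ι → Set V)
    (hC : ∀ i j, i ≠ j → Disjoint (C i) (C j))
    (h : ∀ i, ∃ a ∈ A, ∃ b ∈ B, JoinedOff G (C i)ᶜ a b) : HasDisjointPaths G k A B := by
  classical
  choose a ha b hb p hp using h
  let e : Fin k ≃ ι := (Fintype.equivFinOfCardEq hι).symm
  refine ⟨fun i => a (e i), fun i => b (e i), fun i => (p (e i)).toPath, fun i => ha _,
    fun i => hb _, fun i j hij x hx hx' => ?_⟩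
  have h1 := hp _ _ (SimpleGraph.Walk.support_toPath_subset_support _ hx)
  have h2 := hp _ _ (SimpleGraph.Walk.support_toPath_subset_support _ hx')
  exact Set.disjoint_left.1 (hC _ _ (e.injective.ne hij)) (not_not.1 h1) (not_not.1 h2)

/-- As many disjoint `A`–`T` paths as `T` has vertices, indexed by their endvertices in `T`;
`C v` is the vertex set of the path that ends in `v`. A vertex of a path other than its last one is
joined to `A` outside `T`. -/
theorem HasDisjointPaths.exists_sets_to {G : SimpleGraph V} {A T : Finset V} {k : ℕ}
    (hT : T.card = k) (h : HasDisjointPaths G k A T) :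
    ∃ C : V → Set V, (∀ v ∈ T, ∀ w ∈ T, v ≠ w → Disjoint (C v) (C w)) ∧
      (∀ v ∈ T, ∃ a ∈ A, JoinedOff G (C v)ᶜ a v) ∧
      ∀ v ∈ T, ∀ z ∈ C v, z ≠ v → ∃ a ∈ A, JoinedOff G T a z := by
  classical
  obtain ⟨s, t, p, hs, ht, hp⟩ := h
  have hinj : Function.Injective t := by
    intro i j hij
    by_contra hne
    exact hp i j hne (p i).1.end_mem_support (by rw [hij]; exact (p j).1.end_mem_support)
  have hsurj : ∀ v ∈ T, ∃ i, t i = v := by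
    have himg : Finset.univ.image t = T := by
      apply Finset.eq_of_subset_of_card_le
      · intro v hv
        obtain ⟨i, -, rfl⟩ := Finset.mem_image.1 hv
        exact ht i
      · rw [Finset.card_image_of_injective _ hinj, hT]
        simp
    intro v hv
    rw [← himg] at hv
    simpa using hv
  refine ⟨fun v => {z | ∃ i, t i = v ∧ z ∈ (p i).1.support}, ?_, ?_, ?_⟩
  · rintro v - w - hvw
    rw [Set.disjoint_left]
    rintro z ⟨i, rfl, hi⟩ ⟨j, rfl, hj⟩
    exact hp i j (fun h => hvw (h ▸ rfl)) hi hj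
  · intro v hv
    obtain ⟨i, rfl⟩ := hsurj v hv
    exact ⟨s i, hs i, (p i).1, fun x hx hx' => hx' ⟨i, rfl, hx⟩⟩
  · rintro v - z ⟨i, rfl, hz⟩ hne
    refine ⟨s i, hs i, (p i).1.takeUntil z hz, fun x hx hxT => ?_⟩
    obtain ⟨j, rfl⟩ := hsurj x hxT
    have hx' := (p i).1.support_takeUntil_subset_support hz hx
    by_cases hij : i = j
    · subst hij
      exact SimpleGraph.Walk.endpoint_notMem_support_takeUntil (p i).2 hz hne.symm hx
    · exact hp i j hij hx' (p j).1.end_mem_support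

/-- If `H` arises from `G` by deleting the edge `xy`, then a walk of `G` yields a walk of `H`, or
it crosses `xy` in one of the two directions. -/
theorem JoinedOff.or_through_edge {G H : SimpleGraph V} {x y : V}
    (hdel : ∀ u w, G.Adj u w → H.Adj u w ∨ (u = x ∧ w = y) ∨ (u = y ∧ w = x))
    {S : Set V} {a b : V} (h : JoinedOff G S a b) :
    JoinedOff H S a b ∨ (JoinedOff H S a x ∧ JoinedOff H S y b) ∨
      (JoinedOff H S a y ∧ JoinedOff H S x b) := by
  obtain ⟨p, hp⟩ := h
  induction p with
  | nil => exact .inl (.refl (hp _ (by simp)))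
  | @cons u w b huw q ih =>
    have hu : u ∉ S := hp u (by simp)
    have hw : w ∉ S := hp w (by simp)
    have ih := ih fun z hz => hp z (by simp [hz])
    rcases hdel u w huw with hadj | ⟨rfl, rfl⟩ | ⟨rfl, rfl⟩
    · have := JoinedOff.of_adj hadj hu hw
      rcases ih with ih | ih | ih
      · exact .inl (this.trans ih)
      · exact .inr (.inl ⟨this.trans ih.1, ih.2⟩)
      · exact .inr (.inr ⟨this.trans ih.1, ih.2⟩)
    · rcases ih with ih | ih | ih
      · exact .inr (.inl ⟨.refl hu, ih⟩)
      · exact .inr (.inl ⟨.refl hu, ih.2⟩)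
      · exact .inl ih.2
    · rcases ih with ih | ih | ih
      · exact .inr (.inr ⟨.refl hu, ih⟩)
      · exact .inl ih.2
      · exact .inr (.inr ⟨.refl hu, ih.2⟩)

/-- Let `S` separate `A` from `b` in `H = G - xy`, with `y` not on the side of `A`. Then a walk of
`G` from `A` to `b` outside `R` yields a walk of `H` from `A` to `S ∪ {x}` outside `R`: up to its
first vertex in `S ∪ {x}` it stays on the side of `A`, so it does not use the edge `xy`. -/
theorem JoinedOff.joinedOff_separator {G H : SimpleGraph V} {x y : V}
    (hdel : ∀ u w, G.Adj u w → H.Adj u w ∨ (u = x ∧ w = y) ∨ (u = y ∧ w = x))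
    {S R A : Set V} {b : V} (hb : ∀ a ∈ A, ¬ JoinedOff H S a b)
    (hy : ∀ a ∈ A, ¬ JoinedOff H S a y) {a : V} (ha : a ∈ A) (h : JoinedOff G R a b) :
    ∃ v ∈ insert x S, JoinedOff H R a v := by
  have key : ∀ (u : V) (p : G.Walk u b), (∀ z ∈ p.support, z ∉ R) → JoinedOff H R a u →
      (u ∈ S ∨ JoinedOff H S a u) → ∃ v ∈ insert x S, JoinedOff H R a v := by
    clear h
    intro u p hp hau hu
    induction p with
    | nil => exact ⟨_, .inr (hu.resolve_right (hb a ha)), hau⟩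
    | @cons u w b huw q ih =>
      by_cases hux : u ∈ insert x S
      · exact ⟨u, hux, hau⟩
      have huS : u ∉ S := fun h => hux (.inr h)
      have hu := hu.resolve_left huS
      have hadj : H.Adj u w := by
        rcases hdel u w huw with h | ⟨rfl, -⟩ | ⟨rfl, -⟩
        · exact h
        · exact absurd (.inl rfl) hux
        · exact absurd hu (hy a ha)
      have hwR : w ∉ R := hp w (by simp)
      refine ih hb (fun z hz => hp z (by simp [hz]))
        (hau.trans (.of_adj hadj hau.end_notMem hwR)) ?_
      by_cases hwS : w ∈ S
      · exact .inl hwS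
      · exact .inr (hu.trans (.of_adj hadj huS hwS))
  have haR := h.start_notMem
  obtain ⟨p, hp⟩ := h
  refine key a p hp (.refl haR) ?_
  by_cases haS : a ∈ S
  · exact .inl haS
  · exact .inr (.refl haS)

/-- The gluing step of Göring's proof: disjoint paths of `H = G - xy` from `A` to `S ∪ {x}` and
from `B` to `S ∪ {y}`, where `S` separates `A` from `B` in `H`, meet only in `S`, and fit together
along `S` and the edge `xy`. -/
theorem HasDisjointPaths.glue {G H : SimpleGraph V} [DecidableEq V] (hHG : H ≤ G) {x y : V}
    (hxy : G.Adj x y) {A B S : Finset V} {k : ℕ} (hxS : x ∉ S) (hyS : y ∉ S)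
    (hk : S.card + 1 = k)
    (hS : ∀ a ∈ A, ∀ b ∈ B, ¬ JoinedOff H S a b) (hx : ∃ a ∈ A, JoinedOff H S a x)
    (hy : ∃ b ∈ B, JoinedOff H S b y) (hA : HasDisjointPaths H k A (insert x S))
    (hB : HasDisjointPaths H k B (insert y S)) : HasDisjointPaths G k A B := by
  have hcx : (insert x S).card = k := by rw [Finset.card_insert_of_notMem hxS, hk]
  have hcy : (insert y S).card = k := by rw [Finset.card_insert_of_notMem hyS, hk]
  obtain ⟨C, hC, hCA, hC'⟩ := hA.exists_sets_to hcx
  obtain ⟨D, hD, hDB, hD'⟩ := hB.exists_sets_to hcy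
  have hCself : ∀ v ∈ insert x S, v ∈ C v := fun v hv => by
    obtain ⟨a, -, h⟩ := hCA v hv
    exact not_not.1 h.end_notMem
  have hDself : ∀ v ∈ insert y S, v ∈ D v := fun v hv => by
    obtain ⟨a, -, h⟩ := hDB v hv
    exact not_not.1 h.end_notMem
  -- the correspondence between the ends of the two path systems
  let f : V → V := fun v => if v = x then y else v
  have hfx : f x = y := if_pos rfl
  have hfS : ∀ v ∈ S, f v = v := fun v hv => if_neg (ne_of_mem_of_not_mem hv hxS)
  have hf : ∀ v ∈ insert x S, f v ∈ insert y S := by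
    intro v hv
    rcases Finset.mem_insert.1 hv with rfl | hv
    · simp [hfx]
    · simp [hfS v hv, hv]
  have hfinj : ∀ v ∈ insert x S, ∀ w ∈ insert x S, f v = f w → v = w := by
    intro v hv w hw h
    rcases Finset.mem_insert.1 hv with rfl | hvS <;> rcases Finset.mem_insert.1 hw with rfl | hwS
    · rfl
    · rw [hfx, hfS w hwS] at h
      exact absurd (h ▸ hwS) hyS
    · rw [hfx, hfS v hvS] at h
      exact absurd (h ▸ hvS) hyS
    · rwa [hfS v hvS, hfS w hwS] at h
  have hcross : ∀ v ∈ insert x S, ∀ w ∈ insert x S, v ≠ w → Disjoint (C v) (D (f w)) := by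
    intro v hv w hw hvw
    rw [Set.disjoint_left]
    intro z hzC hzD
    by_cases hzS : z ∈ S
    · have hzv : z = v := by
        by_contra hne
        have hz : z ∈ insert x S := by simp [hzS]
        exact Set.disjoint_left.1 (hC z hz v hv hne) (hCself z hz) hzC
      have hzw : z = f w := by
        by_contra hne
        have hz : z ∈ insert y S := by simp [hzS]
        exact Set.disjoint_left.1 (hD z hz _ (hf w hw) hne) (hDself z hz) hzD
      exact hvw (hfinj v hv w hw (by rw [← hzw, ← hzv, hfS z hzS]))
    · have h1 : ∃ a ∈ A, JoinedOff H S a z := by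
        by_cases hzv : z = v
        · rcases Finset.mem_insert.1 (hzv ▸ hv) with rfl | h
          · exact hx
          · exact absurd h hzS
        · obtain ⟨a, ha, h⟩ := hC' v hv z hzC hzv
          exact ⟨a, ha, h.mono (by simp)⟩
      have h2 : ∃ b ∈ B, JoinedOff H S b z := by
        by_cases hzw : z = f w
        · rcases Finset.mem_insert.1 (hzw ▸ hf w hw) with rfl | h
          · exact hy
          · exact absurd h hzS
        · obtain ⟨b, hb, h⟩ := hD' _ (hf w hw) z hzD hzw
          exact ⟨b, hb, h.mono (by simp)⟩
      obtain ⟨a, ha, h1⟩ := h1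
      obtain ⟨b, hb, h2⟩ := h2
      exact hS a ha b hb (h1.trans h2.symm)
  refine HasDisjointPaths.of_joinedOff (ι := {v // v ∈ insert x S}) (by simpa using hcx)
    (fun v => C v ∪ D (f v)) ?_ ?_
  · rintro ⟨v, hv⟩ ⟨w, hw⟩ hne
    have hvw : v ≠ w := fun h => hne (Subtype.ext h)
    simp only [Set.disjoint_union_left, Set.disjoint_union_right]
    exact ⟨⟨hC v hv w hw hvw, (hcross w hw v hv hvw.symm).symm⟩, hcross v hv w hw hvw,
      hD _ (hf v hv) _ (hf w hw) fun h => hvw (hfinj v hv w hw h)⟩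
  · rintro ⟨v, hv⟩
    obtain ⟨a, ha, h1⟩ := hCA v hv
    obtain ⟨b, hb, h2⟩ := hDB _ (hf v hv)
    have h1 : JoinedOff G (C v ∪ D (f v))ᶜ a v := (h1.mono (by simp)).mono_graph hHG
    have h2 : JoinedOff G (C v ∪ D (f v))ᶜ b (f v) := (h2.mono (by simp)).mono_graph hHG
    have h3 : JoinedOff G (C v ∪ D (f v))ᶜ v (f v) := by
      rcases Finset.mem_insert.1 hv with rfl | hvS
      · exact .of_adj (by rwa [hfx]) h1.end_notMem h2.end_notMem
      · simpa only [hfS v hvS] using JoinedOff.refl h1.end_notMem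
    exact ⟨a, ha, b, hb, (h1.trans h3).trans h2.symm⟩

/-- Menger's theorem for a graph with finitely many edges, by induction on their number. -/
theorem hasDisjointPaths_of_finite_edgeSet {G : SimpleGraph V} (hG : G.edgeSet.Finite)
    {A B : Finset V} {k : ℕ}
    (h : ∀ S : Finset V, S.card < k → ∃ a ∈ A, ∃ b ∈ B, JoinedOff G S a b) :
    HasDisjointPaths G k A B := by
  classical
  induction hn : G.edgeSet.ncard using Nat.strong_induction_on generalizing G A B k with
  | _ n ih =>
  subst hn
  by_cases hE : ∃ x y, G.Adj x y
  · obtain ⟨x, y, hxy⟩ := hE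
    let H := G.deleteEdges {s(x, y)}
    have hHG : H ≤ G := G.deleteEdges_le _
    have hlt : H.edgeSet.ncard < G.edgeSet.ncard := by
      apply Set.ncard_lt_ncard _ hG
      rw [SimpleGraph.edgeSet_deleteEdges]
      exact Set.sdiff_singleton_ssubset.2 hxy
    have hH : H.edgeSet.Finite := hG.subset (SimpleGraph.edgeSet_mono hHG)
    have hdel : ∀ u w, G.Adj u w → H.Adj u w ∨ (u = x ∧ w = y) ∨ (u = y ∧ w = x) := by
      intro u w huw
      by_cases he : s(u, w) = s(x, y)
      · exact .inr (by simpa using he)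
      · exact .inl (by simpa [H, SimpleGraph.deleteEdges_adj, huw] using he)
    by_cases hsep : ∀ S : Finset V, S.card < k → ∃ a ∈ A, ∃ b ∈ B, JoinedOff H S a b
    · obtain ⟨s, t, p, hs, ht, hp⟩ := ih _ hlt hH hsep rfl
      refine ⟨s, t, fun i => ⟨(p i).1.mapLe hHG, (p i).2.mapLe hHG⟩, hs, ht, ?_⟩
      simpa using hp
    push Not at hsep
    obtain ⟨S, hSk, hS⟩ := hsep
    -- the case that the separator is crossed along the edge from `u` to `w`
    have main : ∀ u w, G.Adj u w →
        (∀ a b, G.Adj a b → H.Adj a b ∨ (a = u ∧ b = w) ∨ (a = w ∧ b = u)) →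
        (∃ a ∈ A, JoinedOff H S a u) → (∃ b ∈ B, JoinedOff H S w b) →
        HasDisjointPaths G k A B := by
      rintro u w huw hdel ⟨a₀, ha₀, hau⟩ ⟨b₀, hb₀, hwb⟩
      have hAw : ∀ a ∈ A, ¬ JoinedOff H S a w := fun a ha h => hS a ha b₀ hb₀ (h.trans hwb)
      have hBu : ∀ b ∈ B, ¬ JoinedOff H S b u := fun b hb h =>
        hS a₀ ha₀ b hb (hau.trans h.symm)
      have hcard : S.card + 1 = k := by
        by_contra hne
        obtain ⟨a, ha, b, hb, hab⟩ := h (insert u S)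
          (lt_of_le_of_lt (Finset.card_insert_le _ _) (by omega))
        rcases hab.or_through_edge hdel with h' | h' | h'
        · exact hS a ha b hb (h'.mono (by simp))
        · exact h'.1.end_notMem (by simp)
        · exact h'.2.start_notMem (by simp)
      refine HasDisjointPaths.glue hHG huw hau.end_notMem hwb.start_notMem hcard hS
        ⟨a₀, ha₀, hau⟩ ⟨b₀, hb₀, hwb.symm⟩ (ih _ hlt hH ?_ rfl) (ih _ hlt hH ?_ rfl)
      · intro R hR
        obtain ⟨a, ha, b, hb, hab⟩ := h R hR
        obtain ⟨v, hv, hav⟩ := hab.joinedOff_separator hdel (A := A) (S := S)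
          (fun a ha => hS a ha b hb) hAw ha
        exact ⟨a, ha, v, by simpa using hv, hav⟩
      · intro R hR
        obtain ⟨a, ha, b, hb, hab⟩ := h R hR
        obtain ⟨v, hv, hbv⟩ := hab.symm.joinedOff_separator (x := w) (y := u)
          (fun c d hcd => (hdel c d hcd).imp_right Or.symm) (A := B) (S := S)
          (fun b hb h => hS a ha b hb h.symm) hBu hb
        exact ⟨b, hb, v, by simpa using hv, hbv⟩
    obtain ⟨a, ha, b, hb, hab⟩ := h S hSk
    rcases hab.or_through_edge hdel with h' | h' | h'
    · exact absurd h' (hS a ha b hb)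
    · exact main x y hxy hdel ⟨a, ha, h'.1⟩ ⟨b, hb, h'.2⟩
    · exact main y x hxy.symm (fun c d hcd => (hdel c d hcd).imp_right Or.symm)
        ⟨a, ha, h'.1⟩ ⟨b, hb, h'.2⟩
  · push Not at hE
    have hk : k ≤ (A ∩ B).card := by
      by_contra hlt
      obtain ⟨a, ha, b, hb, p, hp⟩ := h (A ∩ B) (by omega)
      cases p with
      | nil => exact hp a (by simp) (by simp [ha, hb])
      | cons hadj _ => exact hE _ _ hadj
    obtain ⟨T, hT, hTk⟩ := Finset.exists_subset_card_eq hk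
    refine HasDisjointPaths.of_joinedOff (ι := T) (by simpa using hTk)
      (fun v => {v.1}) (fun v w hvw => ?_) fun v => ?_
    · exact Set.disjoint_singleton.2 fun h => hvw (Subtype.ext h)
    · have := hT v.2
      rw [Finset.mem_inter] at this
      exact ⟨v, this.1, v, this.2, .refl (by simp)⟩

/-- For a family of finite sets and a number `n`, some finite set `T` is as good as the whole ground
set as far as avoiding sets of at most `n` points is concerned. -/
theorem exists_finset_forall_avoiding (F : Set (Finset V)) (n : ℕ) :
    ∃ T : Finset V, ∀ X : Finset V, X.card ≤ n → (∃ P ∈ F, Disjoint P X) →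
      ∃ P ∈ F, P ⊆ T ∧ Disjoint P X := by
  classical
  induction n with
  | zero =>
    by_cases hF : ∃ P, P ∈ F
    · obtain ⟨P, hP⟩ := hF
      refine ⟨P, fun X hX _ => ⟨P, hP, subset_rfl, ?_⟩⟩
      rw [Finset.card_eq_zero.1 (Nat.le_zero.1 hX)]
      exact Finset.disjoint_empty_right P
    · exact ⟨∅, fun X _ ⟨P, hP, _⟩ => absurd ⟨P, hP⟩ hF⟩
  | succ n ih =>
    obtain ⟨T, hT⟩ := ih
    -- `c X` is a member of the family that avoids `X`, if there is one
    have hc : ∀ X : Finset V, ∃ P : Finset V, (∃ P ∈ F, Disjoint P X) → P ∈ F ∧ Disjoint P X := by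
      intro X
      by_cases h : ∃ P ∈ F, Disjoint P X
      · obtain ⟨P, hP⟩ := h
        exact ⟨P, fun _ => hP⟩
      · exact ⟨∅, fun h' => absurd h' h⟩
    choose c hc using hc
    refine ⟨T ∪ T.powerset.biUnion c, fun X hX h => ?_⟩
    by_cases hXT : X ⊆ T
    · exact ⟨c X, (hc X h).1, (Finset.subset_biUnion_of_mem c
        (Finset.mem_powerset.2 hXT)).trans Finset.subset_union_right, (hc X h).2⟩
    · -- only the at most `n` points of `X` in `T` matter for the sets inside `T`
      have hlt : (X ∩ T).card < X.card :=
        Finset.card_lt_card ⟨Finset.inter_subset_left, fun h =>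
          hXT (h.trans Finset.inter_subset_right)⟩
      obtain ⟨P, hP, hPT, hPX⟩ := hT (X ∩ T) (by omega)
        (h.imp fun P hP => ⟨hP.1, hP.2.mono_right Finset.inter_subset_left⟩)
      refine ⟨P, hP, hPT.trans Finset.subset_union_left, Finset.disjoint_left.2 fun z hz hzX => ?_⟩
      exact Finset.disjoint_left.1 hPX hz (Finset.mem_inter.2 ⟨hzX, hPT hz⟩)

/-- Some finite set `T` contains, for all sets `X` of at most `n` vertices that do not separate `A`
from `B`, a walk from `A` to `B` outside `X`. -/
theorem exists_finset_joinedOff (G : SimpleGraph V) (A B : Set V) (n : ℕ) :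
    ∃ T : Finset V, ∀ X : Finset V, X.card ≤ n → (∃ a ∈ A, ∃ b ∈ B, JoinedOff G X a b) →
      ∃ a ∈ A, ∃ b ∈ B, JoinedOff G (X ∪ (T : Set V)ᶜ) a b := by
  classical
  obtain ⟨T, hT⟩ := exists_finset_forall_avoiding
    {P : Finset V | ∃ a ∈ A, ∃ b ∈ B, ∃ p : G.Walk a b, p.support.toFinset = P} n
  refine ⟨T, fun X hX ⟨a, ha, b, hb, p, hp⟩ => ?_⟩
  obtain ⟨_, ⟨a, ha, b, hb, p, rfl⟩, hPT, hPX⟩ := hT X hX ⟨_, ⟨a, ha, b, hb, p, rfl⟩,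
    Finset.disjoint_left.2 fun z hz => hp z (by simpa using hz)⟩
  refine ⟨a, ha, b, hb, p, fun z hz hz' => ?_⟩
  have hz : z ∈ p.support.toFinset := by simpa using hz
  exact hz'.elim (fun h => Finset.disjoint_left.1 hPX hz h) fun h => h (hPT hz)

/-- Menger's theorem for finite vertex sets in an arbitrary graph. -/
theorem hasDisjointPaths_of_forall_joinedOff {G : SimpleGraph V} {A B : Finset V} {k : ℕ}
    (h : ∀ S : Finset V, S.card < k → ∃ a ∈ A, ∃ b ∈ B, JoinedOff G S a b) :
    HasDisjointPaths G k A B := by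
  obtain ⟨T, hT⟩ := exists_finset_joinedOff G A B k
  -- the subgraph of `G` induced on `T`, with the other vertices isolated
  let H : SimpleGraph V :=
    { Adj := fun u v => G.Adj u v ∧ u ∈ T ∧ v ∈ T
      symm := ⟨fun u v h => ⟨h.1.symm, h.2.2, h.2.1⟩⟩
      loopless := ⟨fun u h => G.loopless.irrefl u h.1⟩ }
  have hHG : H ≤ G := fun u v h => h.1
  have hfin : H.edgeSet.Finite := by
    classical
    refine (T.sym2.finite_toSet).subset fun e he => ?_
    induction e with
    | _ u v => exact Finset.mk_mem_sym2_iff.2 he.2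
  obtain ⟨s, t, p, hs, ht, hp⟩ := hasDisjointPaths_of_finite_edgeSet hfin (A := A) (B := B)
    (k := k) fun S hS => by
      obtain ⟨a, ha, b, hb, p, hp⟩ := hT S hS.le (h S hS)
      refine ⟨a, ha, b, hb, ?_⟩
      have key : ∀ z ∈ p.support, z ∈ T ∧ z ∉ S := fun z hz => by
        have := hp z hz
        simp only [Set.mem_union, Set.mem_compl_iff, Finset.mem_coe, not_or, not_not] at this
        exact this.symm
      refine ⟨p.transfer H fun e he => ?_, by simpa using fun z hz => (key z hz).2⟩
      induction e with
      | _ u v => exact ⟨p.adj_of_mem_edges he, (key u (p.fst_mem_support_of_mem_edges he)).1,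
          (key v (p.snd_mem_support_of_mem_edges he)).1⟩
  exact ⟨s, t, fun i => ⟨(p i).1.mapLe hHG, (p i).2.mapLe hHG⟩, hs, ht, by simpa using hp⟩

/-! ### The component of `G - S` in which an end lives -/

/-- The component of `G - S` that contains a tail of `R`. It depends only on the end of `R` and is
meant for finite sets `S`. -/
def Ray.component {G : SimpleGraph V} (R : Ray G) (S : Set V) : Set V :=
  {v | ∃ N, ∀ n, N ≤ n → JoinedOff G S v (R.vertex n)}

theorem Ray.component_anti {G : SimpleGraph V} (R : Ray G) {S T : Set V} (h : S ⊆ T) :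
    R.component T ⊆ R.component S :=
  fun _ ⟨N, hN⟩ => ⟨N, fun n hn => (hN n hn).mono h⟩

theorem Ray.notMem_of_mem_component {G : SimpleGraph V} {R : Ray G} {S : Set V} {v : V}
    (h : v ∈ R.component S) : v ∉ S := by
  obtain ⟨N, hN⟩ := h
  exact (hN N le_rfl).start_notMem

theorem JoinedOff.mem_component {G : SimpleGraph V} {R : Ray G} {S : Set V} {u v : V}
    (huv : JoinedOff G S u v) (hv : v ∈ R.component S) : u ∈ R.component S := by
  obtain ⟨N, hN⟩ := hv
  exact ⟨N, fun n hn => huv.trans (hN n hn)⟩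

theorem Ray.joinedOff_of_mem_component {G : SimpleGraph V} {R : Ray G} {S : Set V} {u v : V}
    (hu : u ∈ R.component S) (hv : v ∈ R.component S) : JoinedOff G S u v := by
  obtain ⟨M, hM⟩ := hu
  obtain ⟨N, hN⟩ := hv
  exact (hM (max M N) (le_max_left _ _)).trans (hN (max M N) (le_max_right _ _)).symm

theorem Ray.vertex_mem_component {G : SimpleGraph V} {R : Ray G} {S : Set V} {N : ℕ}
    (hN : ∀ n, N ≤ n → R.vertex n ∉ S) : R.vertex N ∈ R.component S := by
  refine ⟨N, fun n hn => ?_⟩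
  obtain ⟨d, rfl⟩ := Nat.exists_eq_add_of_le hn
  exact R.joinedOff_add hN d

theorem Ray.Equivalent.component_subset {G : SimpleGraph V} {R Q : Ray G} (h : R.Equivalent Q)
    {S : Set V} (hS : S.Finite) : R.component S ⊆ Q.component S := by
  intro v hv
  obtain ⟨M, hM⟩ := R.exists_tail_off hS
  obtain ⟨N, hN⟩ := Q.exists_tail_off hS
  -- delete initial segments of both rays too, so that the walk joins their tails
  have hS' : (S ∪ (R.vertex '' Set.Iio M ∪ Q.vertex '' Set.Iio N)).Finite :=
    hS.union (((Set.finite_Iio M).image _).union ((Set.finite_Iio N).image _))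
  obtain ⟨_, ⟨i, rfl⟩, _, ⟨j, rfl⟩, hij⟩ := h _ hS'
  have hi : M ≤ i := by
    by_contra hlt
    exact hij.start_notMem (.inr (.inl ⟨i, by simpa using hlt, rfl⟩))
  have hj : N ≤ j := by
    by_contra hlt
    exact hij.end_notMem (.inr (.inr ⟨j, by simpa using hlt, rfl⟩))
  have hiR := R.vertex_mem_component (S := S) (N := i) fun n hn => hM n (hi.trans hn)
  have hjQ := Q.vertex_mem_component (S := S) (N := j) fun n hn => hN n (hj.trans hn)
  exact ((R.joinedOff_of_mem_component hv hiR).trans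
    (hij.mono Set.subset_union_left)).mem_component hjQ

/-- Every finite set of vertices misses a tooth of a comb together with its path to a late vertex of
the spine. -/
theorem Comb.exists_tooth_mem_component {G : SimpleGraph V} (C : Comb G) {S : Set V}
    (hS : S.Finite) : ∃ n, C.tooth n ∈ C.spine.component S := by
  obtain ⟨N, hN⟩ := C.spine.exists_tail_off hS
  have hS' : (S ∪ C.spine.vertex '' Set.Iio N).Finite := hS.union ((Set.finite_Iio N).image _)
  obtain ⟨n, hn⟩ : ∃ n, ∀ x ∈ (C.path n).1.support, x ∉ S ∪ C.spine.vertex '' Set.Iio N := by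
    by_contra! hall
    choose x hx hxS using hall
    have hinj : Function.Injective x := by
      intro m n hmn
      by_contra hne
      exact C.disjoint m n hne (hx m) (hmn ▸ hx n)
    exact Set.infinite_range_of_injective hinj (hS'.subset (Set.range_subset_iff.2 hxS))
  have hoff : JoinedOff G (S ∪ C.spine.vertex '' Set.Iio N) (C.foot n) (C.tooth n) :=
    ⟨(C.path n).1, hn⟩
  obtain ⟨i, hi⟩ := C.foot_mem n
  have hNi : N ≤ i := by
    by_contra hlt
    exact hoff.start_notMem (.inr ⟨i, by simpa using hlt, hi⟩)
  refine ⟨n, (hoff.mono Set.subset_union_left).symm.mem_component ?_⟩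
  rw [← hi]
  exact C.spine.vertex_mem_component fun n hn => hN n (hNi.trans hn)

/-! ### A finite set that is highly linked to the end -/

theorem GraphEnd.exists_disjoint_rays {G : SimpleGraph V} {ω : GraphEnd G} {a : ℕ}
    (h : (a : Cardinal) ≤ ω.degree) :
    ∃ R : Fin a → Ray G, (∀ i, (R i).IsIn ω) ∧ ∀ i j, i ≠ j →
      Disjoint (R i).verts (R j).verts := by
  cases a with
  | zero => exact ⟨Fin.elim0, fun i => i.elim0, fun i => i.elim0⟩
  | succ a =>
    have hlt : (a : Cardinal) < ω.degree := lt_of_lt_of_le (by exact_mod_cast a.lt_succ_self) h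
    have h0 : {c : Cardinal | ∃ F : Set (Ray G), (∀ R ∈ F, R.IsIn ω) ∧
        F.PairwiseDisjoint Ray.verts ∧ c = #F}.Nonempty := ⟨_, ∅, by simp, by simp, rfl⟩
    obtain ⟨_, ⟨F, hFω, hF, rfl⟩, hc⟩ := exists_lt_of_lt_csSup h0 hlt
    have hc : ((a + 1 : ℕ) : Cardinal) ≤ #F := by
      rw [Nat.cast_add_one, ← Cardinal.succ_natCast]
      exact Order.succ_le_of_lt hc
    obtain ⟨e⟩ : Nonempty (Fin (a + 1) ↪ F) := Cardinal.lift_mk_le'.1 (by simpa using hc)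
    exact ⟨fun i => (e i).1, fun i => hFω _ (e i).2, fun i j hij =>
      hF (e i).2 (e j).2 fun h => hij (e.injective (Subtype.ext h))⟩

theorem exists_nat_add_eq_of_natCast_le_add {k : ℕ} {c d : Cardinal.{u}}
    (h : (k : Cardinal) ≤ c + d) :
    ∃ a b : ℕ, a + b = k ∧ (a : Cardinal) ≤ c ∧ (b : Cardinal) ≤ d := by
  by_cases hd : (k : Cardinal) ≤ d
  · exact ⟨0, k, by simp, by simp, hd⟩
  · obtain ⟨b, rfl⟩ := Cardinal.lt_aleph0.1 ((not_le.1 hd).trans Cardinal.natCast_lt_aleph0)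
    have hb : b < k := by exact_mod_cast not_le.1 hd
    obtain ⟨a, rfl⟩ := Nat.exists_eq_add_of_le' hb.le
    refine ⟨a, b, rfl, ?_, le_rfl⟩
    rw [Nat.cast_add] at h
    exact (Cardinal.add_le_add_iff_of_lt_aleph0 Cardinal.natCast_lt_aleph0).1 h

/-- If the combined degree of `ω` is at least `k`, then some finite set of vertices cannot be
separated from `ω` by fewer than `k` vertices: it consists of dominating vertices and of
vertices, one on each of some disjoint rays, after which these rays avoid the dominating ones. -/
theorem GraphEnd.exists_finset_meeting_component {G : SimpleGraph V} {k : ℕ} {ω : GraphEnd G}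
    (hω : (k : Cardinal) ≤ ω.combinedDegree) {R₀ : Ray G} (hR₀ : R₀.IsIn ω) :
    ∃ K : Finset V, ∀ S : Finset V, S.card < k → ∃ q ∈ K, q ∈ R₀.component S := by
  classical
  have hequiv : ∀ R : Ray G, R.IsIn ω → R.Equivalent R₀ := fun R hR =>
    Quotient.exact (s := raySetoid G) (hR.trans hR₀.symm)
  obtain ⟨a, b, rfl, ha, hb⟩ := exists_nat_add_eq_of_natCast_le_add hω
  obtain ⟨R, hRω, hR⟩ := GraphEnd.exists_disjoint_rays ha
  obtain ⟨_, hDω, hD⟩ := Cardinal.le_mk_iff_exists_subset.1 hb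
  obtain ⟨D, rfl, hD⟩ := Cardinal.mk_set_eq_nat_iff_finset.1 hD
  choose N hN using fun i => (R i).exists_tail_off D.finite_toSet
  refine ⟨D ∪ Finset.univ.image fun i => (R i).vertex (N i), fun S hS => ?_⟩
  by_cases hDS : D ⊆ S
  · -- some ray avoids the fewer than `a` vertices of `S` outside `D`
    obtain ⟨i, hi⟩ : ∃ i, Disjoint (R i).verts (S \ D : Finset V) := by
      by_contra! hall
      simp only [Set.not_disjoint_iff] at hall
      choose x hxR hxS using hall
      have hinj : Function.Injective x := by
        intro i j hij
        by_contra hne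
        exact Set.disjoint_left.1 (hR i j hne) (hxR i) (hij ▸ hxR j)
      have h1 := Finset.card_le_card_of_injOn (s := Finset.univ) (t := S \ D) x
        (fun i _ => hxS i) hinj.injOn
      rw [Finset.card_sdiff_of_subset hDS, Finset.card_univ, Fintype.card_fin] at h1
      have := Finset.card_le_card hDS
      omega
    refine ⟨(R i).vertex (N i), by simp, (hequiv _ (hRω i)).component_subset S.finite_toSet
      ((R i).vertex_mem_component fun n hn hnS => ?_)⟩
    exact Set.disjoint_left.1 hi ⟨n, rfl⟩ (by
      simpa using ⟨hnS, hN i n hn⟩)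
  · obtain ⟨d, hdD, hdS⟩ := Finset.not_subset.1 hDS
    obtain ⟨Q, hQω, hQ⟩ := hDω hdD
    exact ⟨d, by simp [hdD], (hequiv _ hQω).component_subset S.finite_toSet
      (hQ S S.finite_toSet (by simpa using hdS))⟩

/-! ### Sets of which no small separator cuts off too much -/

/-- A finite set `F` is `k`-linked to the end of `R` if every set `S` of fewer than `k` vertices
leaves at most `|S|` vertices of `F`, those in `S` included, outside the component of `G - S`
that contains a tail of `R`. Equivalently, no `Z ⊆ F` with `|Z| ≤ k` is separated from the end by
fewer than `|Z|` vertices. -/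
def Ray.IsLinked {G : SimpleGraph V} (R : Ray G) (k : ℕ) (F : Finset V) : Prop :=
  ∀ S W : Finset V, S.card < k → W ⊆ F → (∀ v ∈ W, v ∉ R.component S) → W.card ≤ S.card

theorem Ray.IsLinked.subset {G : SimpleGraph V} {R : Ray G} {k : ℕ} {F F' : Finset V}
    (h : R.IsLinked k F) (hF : F' ⊆ F) : R.IsLinked k F' :=
  fun S W hS hW => h S W hS (hW.trans hF)

theorem Ray.isLinked_empty {G : SimpleGraph V} (R : Ray G) (k : ℕ) : R.IsLinked k ∅ := by
  intro S W _ hW _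
  simp [Finset.subset_empty.1 hW]

/-- If some finite set `K` cannot be separated from the end by fewer than `k` vertices, and `A`
meets every component in which the end lives, then a `k`-linked set extends by a vertex of `A`:
any vertex of `A` will do that is not separated from the end by a suitable finite set `U`, which
contains enough walks between `F` and `K`. -/
theorem Ray.IsLinked.exists_insert {G : SimpleGraph V} [DecidableEq V] {R : Ray G} {k : ℕ}
    {F K : Finset V}
    (hK : ∀ S : Finset V, S.card < k → ∃ q ∈ K, q ∈ R.component S) {A : Set V}
    (hA : ∀ S : Set V, S.Finite → ∃ a ∈ A, a ∈ R.component S) (hF : R.IsLinked k F) :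
    ∃ a ∈ A, a ∉ F ∧ R.IsLinked k (insert a F) := by
  choose T hT using fun (W : Finset V) (q : V) => exists_finset_joinedOff G (W : Set V) {q} k
  let U : Finset V := F ∪ F.powerset.biUnion fun W => K.biUnion fun q => T W q
  obtain ⟨a, haA, ha⟩ := hA U U.finite_toSet
  have haF : a ∉ F := fun h => Ray.notMem_of_mem_component ha (by simp [U, h])
  refine ⟨a, haA, haF, fun S W' hS hW' hW'S => ?_⟩
  -- otherwise the separator `S` is tight for a subset `W` of `F`, and cuts off `a` as well
  by_contra hlt
  have hWF : W'.erase a ⊆ F := Finset.subset_insert_iff.1 hW'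
  set W := W'.erase a with hW
  have hWS : ∀ v ∈ W, v ∉ R.component S := fun v hv => hW'S v (Finset.mem_of_mem_erase hv)
  have hWle := hF S W hS hWF hWS
  have haW' : a ∈ W' := by
    by_contra h
    rw [Finset.erase_eq_of_notMem h] at hW
    rw [hW] at hWle
    exact hlt hWle
  have hWcard : W.card = W'.card - 1 := Finset.card_erase_of_mem haW'
  -- `S` cannot lie inside `U`, as `U` does not separate `a` from the end
  have hSU : ¬ S ⊆ U := fun h =>
    hW'S a haW' (R.component_anti (by exact_mod_cast h) ha)
  have hcard : (S ∩ U).card < S.card :=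
    Finset.card_lt_card ⟨Finset.inter_subset_left, fun h => hSU (h.trans Finset.inter_subset_right)⟩
  -- so `S ∩ U` does not separate `W` from the end, and `U` contains a walk that shows this
  obtain ⟨q, hqK, hq⟩ := hK S hS
  obtain ⟨w, hwW, hw⟩ : ∃ w ∈ W, w ∈ R.component (S ∩ U : Finset V) := by
    by_contra! h
    have := hF (S ∩ U) W (hcard.trans hS) hWF h
    omega
  have hq' : q ∈ R.component (S ∩ U : Finset V) := R.component_anti (by simp) hq
  obtain ⟨w, hwW, q', hqq', hwq⟩ := hT W q (S ∩ U) (hcard.trans hS).le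
    ⟨w, hwW, q, rfl, R.joinedOff_of_mem_component hw hq'⟩
  obtain rfl : q' = q := hqq'
  have hTU : T W q' ⊆ U := fun z hz => Finset.mem_union_right _ <|
    Finset.mem_biUnion.2 ⟨W, Finset.mem_powerset.2 hWF, Finset.mem_biUnion.2 ⟨q', hqK, hz⟩⟩
  refine hWS w hwW (JoinedOff.mem_component (hwq.mono fun z hz => ?_) hq)
  by_cases hzU : z ∈ U
  · exact .inl (by simpa using ⟨hz, hzU⟩)
  · exact .inr fun h => hzU (hTU h)

theorem Ray.exists_infinite_isLinked {G : SimpleGraph V} {R : Ray G} {k : ℕ} {K : Finset V}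
    (hK : ∀ S : Finset V, S.card < k → ∃ q ∈ K, q ∈ R.component S) {A : Set V}
    (hA : ∀ S : Set V, S.Finite → ∃ a ∈ A, a ∈ R.component S) :
    ∃ A' ⊆ A, A'.Countable ∧ A'.Infinite ∧ ∀ F : Finset V, (F : Set V) ⊆ A' → R.IsLinked k F := by
  classical
  have hstep : ∀ F : {F : Finset V // R.IsLinked k F},
      ∃ a, a ∈ A ∧ a ∉ F.1 ∧ R.IsLinked k (insert a F.1) :=
    fun F => F.2.exists_insert hK hA
  choose g hgA hgF hg using hstep
  let f : ℕ → {F : Finset V // R.IsLinked k F} := fun n =>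
    Nat.rec ⟨∅, R.isLinked_empty k⟩ (fun _ F => ⟨insert (g F) F.1, hg F⟩) n
  have hf : ∀ n, (f (n + 1)).1 = insert (g (f n)) (f n).1 := fun n => rfl
  have hmono : Monotone fun n => (f n).1 :=
    monotone_nat_of_le_succ fun n => by rw [hf]; exact Finset.subset_insert _ _
  have hmem : ∀ m n, m < n → g (f m) ∈ (f n).1 := fun m n hmn =>
    hmono hmn (Finset.mem_insert_self _ _)
  have hinj : Function.Injective fun n => g (f n) := by
    intro m n hmn
    rcases lt_trichotomy m n with h | h | h
    · exact absurd (by simpa [hmn] using hmem m n h) (hgF (f n))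
    · exact h
    · exact absurd (by simpa [hmn] using hmem n m h) (hgF (f m))
  refine ⟨Set.range fun n => g (f n), Set.range_subset_iff.2 fun n => hgA _,
    Set.countable_range _, Set.infinite_range_of_injective hinj, fun F hF => ?_⟩
  suffices h : ∃ n, F ⊆ (f n).1 by
    obtain ⟨n, hn⟩ := h
    exact (f n).2.subset hn
  choose! i hi using fun v (hv : v ∈ F) => hF hv
  refine ⟨F.sup i + 1, fun v hv => ?_⟩
  rw [← hi v hv]
  exact hmem _ _ (Nat.lt_succ_of_le (Finset.le_sup hv))

theorem Ray.IsLinked.hasDisjointPaths {G : SimpleGraph V} {R : Ray G} {k : ℕ} {Z₁ Z₂ : Finset V}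
    (h₁ : R.IsLinked k Z₁) (h₂ : R.IsLinked k Z₂) (hcard : Z₁.card = Z₂.card)
    (hk : Z₁.card ≤ k) : HasDisjointPaths G Z₁.card Z₁ Z₂ := by
  refine hasDisjointPaths_of_forall_joinedOff fun S hS => ?_
  have key : ∀ Z : Finset V, R.IsLinked k Z → S.card < Z.card → ∃ z ∈ Z, z ∈ R.component S := by
    intro Z hZ hlt
    by_contra! h
    exact absurd (hZ S Z (hS.trans_le hk) subset_rfl h) (by omega)
  obtain ⟨z₁, hz₁, h₁⟩ := key Z₁ h₁ hS
  obtain ⟨z₂, hz₂, h₂⟩ := key Z₂ h₂ (by omega)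
  exact ⟨z₁, hz₁, z₂, hz₂, R.joinedOff_of_mem_component h₁ h₂⟩

end EndConn

theorem mainTheorem6 {V : Type*} (G : SimpleGraph V) (k : ℕ) (ω : EndConn.GraphEnd G)
    (hω : (k : Cardinal) ≤ ω.combinedDegree) (A : Set V) (hA : ω.InClosure A) :
    ∃ A' : Set V, A' ⊆ A ∧ A'.Countable ∧ A'.Infinite ∧ EndConn.IsConnectedSet G k A' := by
  obtain ⟨C, hCω, hCA⟩ := hA
  obtain ⟨K, hK⟩ := ω.exists_finset_meeting_component hω hCω
  obtain ⟨A', hA'A, hcount, hinf, hA'⟩ := EndConn.Ray.exists_infinite_isLinked hK (A := A)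
    fun S hS => by
      obtain ⟨n, hn⟩ := C.exists_tooth_mem_component hS
      exact ⟨_, hCA ⟨n, rfl⟩, hn⟩
  exact ⟨A', hA'A, hcount, hinf, by simp [hinf.encard_eq], fun Z₁ Z₂ h₁ h₂ hcard hk =>
    (hA' Z₁ h₁).hasDisjointPaths (hA' Z₂ h₂) hcard hk⟩
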